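/- **Proposition (Direct Galois closure).** Let $(R,\varsigma)$ be a transformal domain, i.e. an integral domain $R$ with an injective endomorphism $\varsigma$, and let $S=\operatorname{Spec}R$. *Notions.* An algebraic variety over $R$ is a reduced separated $S$-scheme of finite presentation. An almost direct presentation $(X,\Sigma)$ over $(R,\varsigma)$ consists of algebraic varieties $X_0,X_1$ over $R$, an $S$-morphism $\pi_1:X_1\to X_0$ and a family $\Sigma$ of morphisms $\sigma:X_1\to X_0$ lying over $\operatorname{Spec}(\varsigma):S\to S$. A morphism $f:(X,\Sigma)\to(Y,T)$ consists of a map $()^f:\Sigma\to T$ and $S$-morphisms $f_0:X_0\to Y_0$, $f_1:X_1\to Y_1$ with $f_0\pi_1=\pi_1f_1$ and $f_0\sigma=\sigma^ff_1$ for $\sigma\in\Sigma$. Write $X_{0\varsigma}$ for the base change of $X_0$ along $\operatorname{Spec}(\varsigma)$, $f_{0\varsigma}$ for that of $f_0$, and $\pi_2(\sigma):X_1\to X_{0\varsigma}$ for the $S$-morphism induced by $\sigma$. "Directly $P$" means that $X_0,X_1,X_{0\varsigma}$ (respectively $f_0,f_1,f_{0\varsigma}$) have property $P$. When $\Sigma=\{\sigma\}$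 one writes $(X,\sigma)$. A Galois cover is a finite étale surjective morphism $Z\to W$ with $Z$ connected such that $\operatorname{Gal}(Z/W)=\operatorname{Aut}(Z/W)$ acts transitively on geometric fibres. The Galois closure of $Z\to W$ is a Galois cover $\tilde Z\to W$ with a $W$-morphism $\tilde Z\to Z$ through which every $W$-morphism to $Z$ from a Galois cover of $W$ factors. An almost direct Galois cover is a morphism $p:(X,\Sigma)\to(Y,T)$ of almost direct presentations such that (1) $X_i\to Y_i$ is a Galois cover, with group $G_i$, for $i=0,1$; (2) $G_0$ acts on $\Sigma$ by composition, $g\cdot\sigma=g\sigma$, and $()^p$ induces a bijection $G_0\backslash\Sigma\simeq T$; (3) there is a homomorphism $()^{\pi_1}:G_1\to G_0$ with $\pi_1g=g^{\pi_1}\pi_1$ for $g\in G_1$; (4) for every $\sigma\in\Sigma$ there is a homomorphism $()^\sigma:G_1\to G_0$ with $\sigma g=g^\sigma\sigma$ for $g\in G_1$. *Statement.* Let $f:(X,\sigma)\to(Y,\sigma)$ be a directly finite étale morphism of directly integral almost direct presentations over $(R,\varsigma)$. Then the Galois closures of $X_0\to Y_0$ and of $X_{0\varsigma}\to Y_{0\varsigma}$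 exist. For any choice $\tilde X_0\to X_0$ and $\tilde X_{0\varsigma}\to X_{0\varsigma}$ of them, consider the morphism (products without index are over $S$) $$\psi:\ A=(\tilde X_0\times\tilde X_{0\varsigma})\times_{X_0\times X_{0\varsigma}}X_1\ \longrightarrow\ B=(\tilde X_0\times\tilde X_{0\varsigma})\times_{Y_0\times Y_{0\varsigma}}Y_1$$ induced by $f_1$ and the identities, where $X_1\to X_0\times X_{0\varsigma}$ and $Y_1\to Y_0\times Y_{0\varsigma}$ are $(\pi_1,\pi_2(\sigma))$. Then the following hold. 1. $A$ has an open connected component, and every open connected component of $A$ is mapped by $\psi$ into some open connected component of $B$. 2. There is a morphism $c:\tilde X_{0\varsigma}\to\tilde X_0$ lying over the projection $X_{0\varsigma}\to X_0$. 3. Let $c$ be any such morphism, let $\mathring{\tilde X}_1$ be any open connected component of $A$, and let $\tilde X_1$ be an open connected component of $B$ that contains $\psi(\mathring{\tilde X}_1)$. On $\mathring{\tilde X}_1$ and on $\tilde X_1$ let $\pi_1$ and $\pi_2$ be the projections to $\tilde X_0$ and $\tilde X_{0\varsigma}$. Put $$\mathring{\tilde X}=(\tilde X_0,\mathring{\tilde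 X}_1,\pi_1),\quad \mathring\Sigma=\operatorname{Gal}(\tilde X_0/X_0)\,c\,\pi_2,\qquad \tilde X=(\tilde X_0,\tilde X_1,\pi_1),\quad \tilde\Sigma=\operatorname{Gal}(\tilde X_0/Y_0)\,c\,\pi_2 .$$ Then the projections $(\mathring{\tilde X},\mathring\Sigma)\to(X,\sigma)$ and $(\tilde X,\tilde\Sigma)\to(Y,\sigma)$ are almost direct Galois covers (in particular, morphisms of almost direct presentations), and there is a morphism $(\mathring{\tilde X},\mathring\Sigma)\to(\tilde X,\tilde\Sigma)$, given by $\mathrm{id}_{\tilde X_0}$ and the restriction of $\psi$, such that the square formed with $f$ and the two covers commutes. -/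

import Mathlib

open CategoryTheory CategoryTheory.Limits AlgebraicGeometry

universe u

/-! ### Varieties, finite étale morphisms, Galois covers and Galois closures -/

/-- `X` is an algebraic variety over `S` via `s`: reduced, separated and of finite presentation. -/
structure IsAlgebraicVariety {X S : Scheme.{u}} (s : X ⟶ S) : Prop where
  isReduced : IsReduced X
  isSeparated : IsSeparated s
  locallyOfFinitePresentation : LocallyOfFinitePresentation s
  quasiCompact : QuasiCompact s

/-- Finite étale morphisms of schemes. -/
def finiteEtale : MorphismProperty Scheme.{u} := fun _ _ p => IsFinite p ∧ Etale p

/-- `p : X ⟶ Y` is a (finite étale, connected) Galois cover: the group `Aut (X/Y)` acts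
transitively on the geometric points of `X` over any given geometric point of `Y`. -/
structure IsGaloisCover {X Y : Scheme.{u}} (p : X ⟶ Y) : Prop where
  finiteEtale : finiteEtale p
  surjective : Surjective p
  connected : ConnectedSpace X
  transitive : ∀ (Ω : Type u) [Field Ω] [IsAlgClosed Ω] (x x' : Spec (CommRingCat.of Ω) ⟶ X),
    x ≫ p = x' ≫ p → ∃ g : Aut (Over.mk p), x ≫ g.hom.left = x'

/-- `q : P ⟶ X` exhibits `P` as the Galois closure of the cover `f : X ⟶ Y`: `P` is a Galois cover
of `Y` via `q ≫ f`, and every Galois cover of `Y` that dominates `X` factors through `P`. -/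
structure IsGaloisClosure {P X Y : Scheme.{u}} (q : P ⟶ X) (f : X ⟶ Y) : Prop where
  isGaloisCover : IsGaloisCover (q ≫ f)
  dominated : ∀ {Z : Scheme.{u}} (h : Z ⟶ X), IsGaloisCover (h ≫ f) → ∃ v : Z ⟶ P, v ≫ q = h

/-- The open subset `U` of `X` is a connected component of `X`. -/
def IsComponent {X : Scheme.{u}} (U : X.Opens) : Prop :=
  ∃ x : X, (U : Set X) = connectedComponent x

/-! ### Almost direct presentations -/

/-- The diagrams underlying almost direct presentations over the difference ring `(R, ς)`:
two schemes `X₀`, `X₁` over `S = Spec R`, an `S`-morphism `π₁ : X₁ ⟶ X₀`, and a family of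
morphisms `σ s : X₁ ⟶ X₀` which lie over `Spec ς : S ⟶ S`. -/
structure TwistedDiagram {R : Type u} [CommRing R] (ς : R →+* R) : Type (u + 1) where
  X₀ : Scheme.{u}
  X₁ : Scheme.{u}
  str₀ : X₀ ⟶ Spec (CommRingCat.of R)
  str₁ : X₁ ⟶ Spec (CommRingCat.of R)
  π₁ : X₁ ⟶ X₀
  /-- The index set of the family of twisted morphisms. -/
  Idx : Type u
  σ : Idx → (X₁ ⟶ X₀)
  π₁_str : π₁ ≫ str₀ = str₁
  σ_str : ∀ s, σ s ≫ str₀ = str₁ ≫ Spec.map (CommRingCat.ofHom ς)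

namespace TwistedDiagram

variable {R : Type u} [CommRing R] {ς : R →+* R}

/-- Morphisms `(X, Σ) ⟶ (Y, T)`: a map `Σ → T` and `S`-morphisms `X₀ ⟶ Y₀` and `X₁ ⟶ Y₁`
which commute with all the structure. -/
@[ext]
structure Hom (X Y : TwistedDiagram.{u} ς) where
  idx : X.Idx → Y.Idx
  f₀ : X.X₀ ⟶ Y.X₀
  f₁ : X.X₁ ⟶ Y.X₁
  f₀_str : f₀ ≫ Y.str₀ = X.str₀
  f₁_str : f₁ ≫ Y.str₁ = X.str₁
  π₁_comm : X.π₁ ≫ f₀ = f₁ ≫ Y.π₁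
  σ_comm : ∀ s, X.σ s ≫ f₀ = f₁ ≫ Y.σ (idx s)

instance : Category (TwistedDiagram.{u} ς) where
  Hom := Hom
  id X :=
    { idx := id
      f₀ := 𝟙 _
      f₁ := 𝟙 _
      f₀_str := by simp
      f₁_str := by simp
      π₁_comm := by simp
      σ_comm := by simp }
  comp f g :=
    { idx := g.idx ∘ f.idx
      f₀ := f.f₀ ≫ g.f₀
      f₁ := f.f₁ ≫ g.f₁
      f₀_str := by rw [Category.assoc, g.f₀_str, f.f₀_str]
      f₁_str := by rw [Category.assoc, g.f₁_str, f.f₁_str]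
      π₁_comm := by rw [← Category.assoc, f.π₁_comm, Category.assoc, g.π₁_comm, Category.assoc]
      σ_comm := fun s => by
        rw [← Category.assoc, f.σ_comm, Category.assoc, g.σ_comm, Category.assoc]
        rfl }
  id_comp f := by apply Hom.ext <;> simp
  comp_id f := by apply Hom.ext <;> simp
  assoc f g h := by apply Hom.ext <;> simp [Function.comp_assoc]

/-- The objects of the category of almost direct presentations (a full subcategory): `X₀` and `X₁`
are algebraic varieties over `R`. -/
structure IsAlmostDirectPresentation (X : TwistedDiagram.{u} ς) : Prop where
  variety₀ : IsAlgebraicVariety X.str₀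
  variety₁ : IsAlgebraicVariety X.str₁

/-- The base change `X_{0ς}` of `X₀` along `Spec ς : S ⟶ S`. -/
noncomputable def twist (X : TwistedDiagram.{u} ς) : Scheme.{u} :=
  pullback X.str₀ (Spec.map (CommRingCat.ofHom ς))

/-- The structure morphism `X_{0ς} ⟶ S`. -/
noncomputable def twistStr (X : TwistedDiagram.{u} ς) : X.twist ⟶ Spec (CommRingCat.of R) :=
  pullback.snd X.str₀ (Spec.map (CommRingCat.ofHom ς))

/-- The projection `X_{0ς} ⟶ X₀`, which lies over `Spec ς`. -/
noncomputable def twistProj (X : TwistedDiagram.{u} ς) : X.twist ⟶ X.X₀ :=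
  pullback.fst X.str₀ (Spec.map (CommRingCat.ofHom ς))

lemma twist_condition (X : TwistedDiagram.{u} ς) :
    X.twistProj ≫ X.str₀ = X.twistStr ≫ Spec.map (CommRingCat.ofHom ς) :=
  pullback.condition

/-- The `S`-morphism `π₂(σ) : X₁ ⟶ X_{0ς}` induced by `σ : X₁ ⟶ X₀`. -/
noncomputable def π₂ (X : TwistedDiagram.{u} ς) (s : X.Idx) : X.X₁ ⟶ X.twist :=
  pullback.lift (X.σ s) X.str₁ (X.σ_str s)

lemma π₂_twistProj (X : TwistedDiagram.{u} ς) (s : X.Idx) : X.π₂ s ≫ X.twistProj = X.σ s :=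
  pullback.lift_fst _ _ _

lemma π₂_twistStr (X : TwistedDiagram.{u} ς) (s : X.Idx) : X.π₂ s ≫ X.twistStr = X.str₁ :=
  pullback.lift_snd _ _ _

/-- The base change `f_{0ς} : X_{0ς} ⟶ Y_{0ς}` of `f₀`. -/
noncomputable def Hom.twist {X Y : TwistedDiagram.{u} ς} (f : X ⟶ Y) : X.twist ⟶ Y.twist :=
  pullback.lift (X.twistProj ≫ f.f₀) X.twistStr
    (by rw [Category.assoc, f.f₀_str, X.twist_condition])

lemma Hom.twist_twistProj {X Y : TwistedDiagram.{u} ς} (f : X ⟶ Y) :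
    Hom.twist f ≫ Y.twistProj = X.twistProj ≫ f.f₀ :=
  pullback.lift_fst _ _ _

lemma Hom.twist_twistStr {X Y : TwistedDiagram.{u} ς} (f : X ⟶ Y) :
    Hom.twist f ≫ Y.twistStr = X.twistStr :=
  pullback.lift_snd _ _ _

lemma Hom.π₂_comm {X Y : TwistedDiagram.{u} ς} (f : X ⟶ Y) (s : X.Idx) :
    X.π₂ s ≫ Hom.twist f = f.f₁ ≫ Y.π₂ (f.idx s) := by
  apply pullback.hom_ext
  · change (X.π₂ s ≫ Hom.twist f) ≫ Y.twistProj = (f.f₁ ≫ Y.π₂ (f.idx s)) ≫ Y.twistProj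
    rw [Category.assoc, Hom.twist_twistProj, ← Category.assoc, π₂_twistProj, Category.assoc,
      π₂_twistProj, f.σ_comm]
  · change (X.π₂ s ≫ Hom.twist f) ≫ Y.twistStr = (f.f₁ ≫ Y.π₂ (f.idx s)) ≫ Y.twistStr
    rw [Category.assoc, Hom.twist_twistStr, π₂_twistStr, Category.assoc, π₂_twistStr, f.f₁_str]

/-- `X` is directly `P`: the schemes `X₀`, `X₁` and `X_{0ς}` have the property `P`. -/
def IsDirectly (P : Scheme.{u} → Prop) (X : TwistedDiagram.{u} ς) : Prop :=
  P X.X₀ ∧ P X.X₁ ∧ P X.twist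

/-- `f` is directly `P`: the morphisms `f₀`, `f₁` and `f_{0ς}` have the property `P`. -/
def Hom.IsDirectly (P : MorphismProperty Scheme.{u}) {X Y : TwistedDiagram.{u} ς} (f : X ⟶ Y) :
    Prop :=
  P f.f₀ ∧ P f.f₁ ∧ P (Hom.twist f)

/-- Almost direct Galois covers. Products in `Aut` are compositions, so that `g • σ = g ∘ σ` is a
left action. -/
structure IsAlmostDirectGaloisCover {X Y : TwistedDiagram.{u} ς} (p : X ⟶ Y) : Prop where
  source : X.IsAlmostDirectPresentation
  target : Y.IsAlmostDirectPresentation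
  galois₀ : IsGaloisCover p.f₀
  galois₁ : IsGaloisCover p.f₁
  /-- `G₀` acts on the twisted morphisms of `X` by composition, and `Y.Idx` is the orbit set. -/
  action : ∃ _ : MulAction (Aut (Over.mk p.f₀)) X.Idx,
    (∀ (g : Aut (Over.mk p.f₀)) (s : X.Idx), X.σ (g • s) = X.σ s ≫ g.hom.left) ∧
    Function.Surjective p.idx ∧
    ∀ s s' : X.Idx, p.idx s = p.idx s' ↔ ∃ g : Aut (Over.mk p.f₀), g • s = s'
  /-- The homomorphism `G₁ → G₀` which belongs to `π₁`. -/
  hom_π₁ : ∃ φ : Aut (Over.mk p.f₁) →* Aut (Over.mk p.f₀),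
    ∀ g, g.hom.left ≫ X.π₁ = X.π₁ ≫ (φ g).hom.left
  /-- The homomorphisms `G₁ → G₀` which belong to the twisted morphisms. -/
  hom_σ : ∀ s : X.Idx, ∃ φ : Aut (Over.mk p.f₁) →* Aut (Over.mk p.f₀),
    ∀ g, g.hom.left ≫ X.σ s = X.σ s ≫ (φ g).hom.left

/-! ### The construction of the direct Galois closure -/

/-- The object `(Z, Aut (Z₀/Y₀) τ)` over `(Y, σ)`, given by morphisms `Z₀ ⟶ Y₀`, `Z₁ ⟶ Y₁`, a
lift `ϖ : Z₁ ⟶ Z₀` of `π₁` and a lift `τ : Z₁ ⟶ Z₀` of `σ`. -/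
noncomputable def orbitObj (Y : TwistedDiagram.{u} ς) (t : Y.Idx) {Z₀ Z₁ : Scheme.{u}} (p₀ : Z₀ ⟶ Y.X₀)
    (p₁ : Z₁ ⟶ Y.X₁) (ϖ τ : Z₁ ⟶ Z₀) (hϖ : ϖ ≫ p₀ = p₁ ≫ Y.π₁)
    (hτ : τ ≫ p₀ = p₁ ≫ Y.σ t) : TwistedDiagram.{u} ς where
  X₀ := Z₀
  X₁ := Z₁
  str₀ := p₀ ≫ Y.str₀
  str₁ := p₁ ≫ Y.str₁
  π₁ := ϖ
  Idx := {ρ : Z₁ ⟶ Z₀ // ∃ g : Aut (Over.mk p₀), ρ = τ ≫ g.hom.left}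
  σ := fun ρ => ρ.1
  π₁_str := by rw [← Category.assoc, hϖ, Category.assoc, Y.π₁_str]
  σ_str := by
    rintro ⟨ρ, g, rfl⟩
    have hg : g.hom.left ≫ p₀ = p₀ := Over.w g.hom
    change (τ ≫ g.hom.left) ≫ p₀ ≫ Y.str₀ = _
    rw [Category.assoc, ← Category.assoc g.hom.left, hg, ← Category.assoc τ, hτ, Category.assoc,
      Y.σ_str, Category.assoc]

/-- The morphism `(Z, Aut (Z₀/Y₀) τ) ⟶ (Y, σ)`. -/
noncomputable def orbitMap (Y : TwistedDiagram.{u} ς) (t : Y.Idx) {Z₀ Z₁ : Scheme.{u}} (p₀ : Z₀ ⟶ Y.X₀)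
    (p₁ : Z₁ ⟶ Y.X₁) (ϖ τ : Z₁ ⟶ Z₀) (hϖ : ϖ ≫ p₀ = p₁ ≫ Y.π₁)
    (hτ : τ ≫ p₀ = p₁ ≫ Y.σ t) : Y.orbitObj t p₀ p₁ ϖ τ hϖ hτ ⟶ Y where
  idx := fun _ => t
  f₀ := p₀
  f₁ := p₁
  f₀_str := rfl
  f₁_str := rfl
  π₁_comm := hϖ
  σ_comm := by
    rintro ⟨ρ, g, rfl⟩
    have hg : g.hom.left ≫ p₀ = p₀ := Over.w g.hom
    change (τ ≫ g.hom.left) ≫ p₀ = p₁ ≫ Y.σ t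
    rw [Category.assoc, hg, hτ]

/-- The morphism `X₁ ⟶ X₀ ×_S X_{0ς}` with components `π₁` and `π₂(σ)`. -/
noncomputable def corr (X : TwistedDiagram.{u} ς) (s : X.Idx) :
    X.X₁ ⟶ pullback X.str₀ X.twistStr :=
  pullback.lift X.π₁ (X.π₂ s) (by rw [X.π₁_str, X.π₂_twistStr])

/-- The product `P₀ ×_S P' ⟶ X₀ ×_S X_{0ς}` of two morphisms `P₀ ⟶ X₀` and `P' ⟶ X_{0ς}`. -/
noncomputable def prodMap (X : TwistedDiagram.{u} ς) {P₀ P' : Scheme.{u}} (a : P₀ ⟶ X.X₀)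
    (a' : P' ⟶ X.twist) :
    pullback (a ≫ X.str₀) (a' ≫ X.twistStr) ⟶ pullback X.str₀ X.twistStr :=
  pullback.lift (pullback.fst _ _ ≫ a) (pullback.snd _ _ ≫ a')
    (by simpa only [Category.assoc] using pullback.condition)

/-- The fibre product `(P₀ ×_S P') ×_{X₀ ×_S X_{0ς}} X₁`. -/
noncomputable def fibreProd (X : TwistedDiagram.{u} ς) (s : X.Idx) {P₀ P' : Scheme.{u}}
    (a : P₀ ⟶ X.X₀) (a' : P' ⟶ X.twist) : Scheme.{u} :=
  pullback (X.prodMap a a') (X.corr s)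

/-- The projection of the fibre product to `P₀`. -/
noncomputable def fibreProdFst (X : TwistedDiagram.{u} ς) (s : X.Idx) {P₀ P' : Scheme.{u}}
    (a : P₀ ⟶ X.X₀) (a' : P' ⟶ X.twist) : X.fibreProd s a a' ⟶ P₀ :=
  pullback.fst (X.prodMap a a') (X.corr s) ≫ pullback.fst _ _

/-- The projection of the fibre product to `P'`. -/
noncomputable def fibreProdSnd (X : TwistedDiagram.{u} ς) (s : X.Idx) {P₀ P' : Scheme.{u}}
    (a : P₀ ⟶ X.X₀) (a' : P' ⟶ X.twist) : X.fibreProd s a a' ⟶ P' :=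
  pullback.fst (X.prodMap a a') (X.corr s) ≫ pullback.snd _ _

/-- The projection of the fibre product to `X₁`. -/
noncomputable def fibreProdBase (X : TwistedDiagram.{u} ς) (s : X.Idx) {P₀ P' : Scheme.{u}}
    (a : P₀ ⟶ X.X₀) (a' : P' ⟶ X.twist) : X.fibreProd s a a' ⟶ X.X₁ :=
  pullback.snd (X.prodMap a a') (X.corr s)

lemma fibreProd_fst_comm (X : TwistedDiagram.{u} ς) (s : X.Idx) {P₀ P' : Scheme.{u}}
    (a : P₀ ⟶ X.X₀) (a' : P' ⟶ X.twist) :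
    X.fibreProdFst s a a' ≫ a = X.fibreProdBase s a a' ≫ X.π₁ := by
  have h := congrArg (· ≫ pullback.fst X.str₀ X.twistStr)
    (pullback.condition (f := X.prodMap a a') (g := X.corr s))
  simp only [prodMap, corr, Category.assoc, pullback.lift_fst] at h
  exact (Category.assoc _ _ _).trans h

lemma fibreProd_snd_comm (X : TwistedDiagram.{u} ς) (s : X.Idx) {P₀ P' : Scheme.{u}}
    (a : P₀ ⟶ X.X₀) (a' : P' ⟶ X.twist) :
    X.fibreProdSnd s a a' ≫ a' = X.fibreProdBase s a a' ≫ X.π₂ s := by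
  have h := congrArg (· ≫ pullback.snd X.str₀ X.twistStr)
    (pullback.condition (f := X.prodMap a a') (g := X.corr s))
  simp only [prodMap, corr, Category.assoc, pullback.lift_snd] at h
  exact (Category.assoc _ _ _).trans h

/-- The morphism of fibre products
`(P₀ ×_S P') ×_{X₀ ×_S X_{0ς}} X₁ ⟶ (P₀ ×_S P') ×_{Y₀ ×_S Y_{0ς}} Y₁` induced by the identities
of `P₀` and `P'` and by `f₁`. -/
noncomputable def fibreProdMap {X Y : TwistedDiagram.{u} ς} (f : X ⟶ Y) (s : X.Idx)
    {P₀ P' : Scheme.{u}} (a : P₀ ⟶ X.X₀) (a' : P' ⟶ X.twist) :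
    X.fibreProd s a a' ⟶ Y.fibreProd (f.idx s) (a ≫ f.f₀) (a' ≫ Hom.twist f) :=
  pullback.lift
    (pullback.lift (X.fibreProdFst s a a') (X.fibreProdSnd s a a') (by
      simp only [Category.assoc, f.f₀_str, Hom.twist_twistStr]
      rw [← Category.assoc, fibreProd_fst_comm, ← Category.assoc, fibreProd_snd_comm,
        Category.assoc, Category.assoc, X.π₁_str, X.π₂_twistStr]))
    (X.fibreProdBase s a a' ≫ f.f₁) (by
      apply pullback.hom_ext
      · simp only [prodMap, corr, Category.assoc, pullback.lift_fst, pullback.lift_fst_assoc]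
        rw [← Category.assoc, fibreProd_fst_comm, Category.assoc, f.π₁_comm]
      · simp only [prodMap, corr, Category.assoc, pullback.lift_snd, pullback.lift_snd_assoc]
        rw [← Category.assoc, fibreProd_snd_comm, Category.assoc, Hom.π₂_comm])

/-- The object `(P₀, U, G₀ τ)` attached to an open subscheme `U` of the fibre product
`(P₀ ×_S P') ×_{Y₀ ×_S Y_{0ς}} Y₁` and a morphism `c : P' ⟶ P₀` over `Y_{0ς} ⟶ Y₀`. Its first
morphism is the projection `U ⟶ P₀`, its twisted morphisms are the composites of
`τ : U ⟶ P' ⟶ P₀` with the elements of `G₀ = Aut (P₀/Y₀)`. -/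
noncomputable def closureObj (Y : TwistedDiagram.{u} ς) (t : Y.Idx) {P₀ P' : Scheme.{u}}
    (a : P₀ ⟶ Y.X₀) (a' : P' ⟶ Y.twist) (c : P' ⟶ P₀) (hc : c ≫ a = a' ≫ Y.twistProj)
    (U : (Y.fibreProd t a a').Opens) : TwistedDiagram.{u} ς :=
  Y.orbitObj t a (U.ι ≫ Y.fibreProdBase t a a') (U.ι ≫ Y.fibreProdFst t a a')
    (U.ι ≫ Y.fibreProdSnd t a a' ≫ c)
    (by rw [Category.assoc, fibreProd_fst_comm, Category.assoc])
    (by rw [Category.assoc, Category.assoc, hc, ← Category.assoc (Y.fibreProdSnd t a a'),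
          fibreProd_snd_comm, Category.assoc, Category.assoc, π₂_twistProj])

/-- The projection of `closureObj` to `Y`. -/
noncomputable def closureMap (Y : TwistedDiagram.{u} ς) (t : Y.Idx) {P₀ P' : Scheme.{u}}
    (a : P₀ ⟶ Y.X₀) (a' : P' ⟶ Y.twist) (c : P' ⟶ P₀) (hc : c ≫ a = a' ≫ Y.twistProj)
    (U : (Y.fibreProd t a a').Opens) : Y.closureObj t a a' c hc U ⟶ Y :=
  Y.orbitMap t _ _ _ _ _ _

lemma comparison_comp {X Y : TwistedDiagram.{u} ς} (f : X ⟶ Y) {P₀ P' : Scheme.{u}}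
    {a : P₀ ⟶ X.X₀} {a' : P' ⟶ X.twist} {c : P' ⟶ P₀} (hc : c ≫ a = a' ≫ X.twistProj) :
    c ≫ a ≫ f.f₀ = (a' ≫ Hom.twist f) ≫ Y.twistProj := by
  rw [← Category.assoc, hc, Category.assoc, Category.assoc, Hom.twist_twistProj]

end TwistedDiagram

/-! Everything rests on rigidity: morphisms from a connected scheme to a separated étale cover which
lie over the same morphism agree once they agree at one point (`eq_of_comp_eq_of_connectedSpace`).
So it suffices to compare geometric points.

Galois closures: let the fibre of `f : X ⟶ Y` over a geometric point have `n` elements. An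
enumeration of them is a point of the `n`-fold fibre power of `X` over `Y`; take the component `U`
through it. By rigidity the coordinates are distinct everywhere on `U`, and they enumerate every
geometric fibre (`exists_comp_eq_of_enumerates`). Two points of `U` over the same point of `Y` thus
differ by a permutation of coordinates, an automorphism of the fibre power which preserves `U`, so
`U` is Galois (`exists_isSplittingCover`). If a Galois cover `Z` of `Y` dominates `X`, its Galois
translates of `Z ⟶ X` enumerate a fibre, so they define a morphism to `U`. The same argument works
when `Z` is Galois over a base change of `Y` (`IsSplittingCover.exists_lift_of_isPullback`), and
this yields `c`.

Components of `A` and `B`: two points over the same point of the base differ by a pair of Galois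
elements acting on the two factors, so every component is a Galois cover
(`isGaloisCover_fibreProd_component`). The homomorphisms between Galois groups again come from
rigidity (`IsGaloisCover.exists_monoidHom`). -/

namespace AlgebraicGeometry

/-! ### Rigidity and geometric points -/

/-- Two morphisms from a connected scheme to a separated étale cover, lying over the same morphism,
agree as soon as they agree at one point. -/
lemma eq_of_comp_eq_of_connectedSpace {U P X T : Scheme.{u}} [ConnectedSpace U] [Nonempty T]
    (p : P ⟶ X) [Etale p] [IsSeparated p] {a b : U ⟶ P} (h : a ≫ p = b ≫ p)
    (x : T ⟶ U) (hx : x ≫ a = x ≫ b) : a = b := by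
  -- The diagonal of a separated étale morphism is an open and closed immersion. Hence so is the
  -- equalizer `e` of `a` and `b`; it contains the image of `x`, so it is all of the connected `U`.
  let d : P ⟶ pullback p p := pullback.lift (𝟙 P) (𝟙 P) rfl
  have hd₁ : IsOpenImmersion d := inferInstanceAs (IsOpenImmersion (pullback.diagonal p))
  have hd₂ : IsClosedImmersion d := inferInstanceAs (IsClosedImmersion (pullback.diagonal p))
  let e := pullback.fst (pullback.lift a b h) d
  have he₁ : IsOpenImmersion e := inferInstance
  have he₂ : IsClosedImmersion e := inferInstance
  let v : T ⟶ pullback (pullback.lift a b h) d := pullback.lift x (x ≫ a) (by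
    apply pullback.hom_ext <;>
      simp [d, hx, pullback.lift_fst, pullback.lift_snd])
  have hr : Set.range e = Set.univ :=
    IsClopen.eq_univ ⟨e.isClosedEmbedding.isClosed_range, e.isOpenEmbedding.isOpen_range⟩
      ⟨_, v (Classical.arbitrary T), rfl⟩
  have : IsIso e := (isIso_iff_isOpenImmersion_and_surjective e).2
    ⟨he₁, ⟨Set.range_eq_univ.1 hr⟩⟩
  rw [← cancel_epi e]
  have hc : e ≫ pullback.lift a b h = _ := pullback.condition
  have h₁ := congrArg (· ≫ pullback.fst p p) hc
  have h₂ := congrArg (· ≫ pullback.snd p p) hc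
  simp only [Category.assoc, d, pullback.lift_fst, pullback.lift_snd] at h₁ h₂
  rw [h₁, h₂]

/-- Every point of a scheme is the image of a geometric point. -/
lemma exists_geometricPoint (X : Scheme.{u}) (x : X) :
    ∃ (Ω : Type u) (_ : Field Ω) (_ : IsAlgClosed Ω) (a : Spec (CommRingCat.of Ω) ⟶ X),
      ∀ t, a t = x := by
  refine ⟨AlgebraicClosure (X.residueField x), inferInstance, inferInstance,
    Spec.map (CommRingCat.ofHom (algebraMap (X.residueField x) _)) ≫ X.fromSpecResidueField x, ?_⟩
  intro t
  rw [Scheme.Hom.comp_apply, Scheme.fromSpecResidueField_apply]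

section GeometricPoints

variable {Z W : Scheme.{u}} {Ω : Type u} [Field Ω] [IsAlgClosed Ω]

/-- Geometric points lift along finite surjective morphisms. -/
lemma exists_lift_geometricPoint (p : Z ⟶ W) [IsFinite p] [Surjective p]
    (w : Spec (CommRingCat.of Ω) ⟶ W) : ∃ z : Spec (CommRingCat.of Ω) ⟶ Z, z ≫ p = w := by
  obtain ⟨y, -⟩ := (pullback.snd p w).surjective (IsLocalRing.closedPoint Ω)
  have : CompactSpace ↥(pullback p w) := QuasiCompact.compactSpace_of_compactSpace (pullback.snd p w)
  have : Nonempty ↥(pullback p w) := ⟨y⟩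
  -- The fibre is nonempty and quasi-compact, so it has a closed point; this is rational, since `Ω`
  -- is algebraically closed.
  obtain ⟨x, -, hx⟩ := (isClosed_univ (X := ↥(pullback p w))).exists_closed_singleton
    Set.univ_nonempty
  refine ⟨pointOfClosedPoint (pullback.snd p w) x hx ≫ pullback.fst p w, ?_⟩
  rw [Category.assoc, pullback.condition, pointOfClosedPoint_comp_assoc]

/-- The geometric fibres of a finite morphism are finite. -/
lemma finite_lifts_geometricPoint (p : Z ⟶ W) [IsFinite p]
    (w : Spec (CommRingCat.of Ω) ⟶ W) :
    Finite {z : Spec (CommRingCat.of Ω) ⟶ Z // z ≫ p = w} := by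
  have h₁ : Finite ↥(pullback p w) := by
    have := (pullback.snd p w).finite_preimage (Set.toFinite Set.univ)
    rwa [Set.preimage_univ, Set.finite_univ_iff] at this
  have := Finite.of_equiv _ (pointEquivClosedPoint (pullback.snd p w)).symm
  refine Finite.of_injective (β := {t : Spec (CommRingCat.of Ω) ⟶ pullback p w //
    t ≫ pullback.snd p w = 𝟙 _})
    (fun z => ⟨pullback.lift z.1 (𝟙 _) (by simp [z.2]), pullback.lift_snd _ _ _⟩) ?_
  intro z z' h
  have := congrArg (fun t => t.1 ≫ pullback.fst p w) h
  simpa [Subtype.ext_iff, pullback.lift_fst] using this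

end GeometricPoints

/-! ### Finite étale morphisms: clopen images, open components, reducedness -/

section FiniteEtale

variable {X Y Z : Scheme.{u}}

lemma surjective_of_isFinite_of_etale (p : X ⟶ Y) [IsFinite p] [Etale p] [Nonempty X]
    [ConnectedSpace Y] : Surjective p := by
  refine ⟨Set.range_eq_univ.1 (IsClopen.eq_univ ⟨?_, ?_⟩ (Set.range_nonempty _))⟩
  · exact p.isClosedMap.isClosed_range
  · exact p.isOpenMap.isOpen_range

lemma finiteEtale_comp {p : X ⟶ Y} {q : Y ⟶ Z} (hp : finiteEtale p) (hq : finiteEtale q) :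
    finiteEtale (p ≫ q) := by
  obtain ⟨_, _⟩ := hp
  obtain ⟨_, _⟩ := hq
  exact ⟨inferInstance, inferInstance⟩

lemma finiteEtale_of_comp {p : X ⟶ Y} {q : Y ⟶ Z} (h : finiteEtale (p ≫ q))
    (hq : finiteEtale q) : finiteEtale p := by
  obtain ⟨_, _⟩ := h
  obtain ⟨_, _⟩ := hq
  exact ⟨IsFinite.of_comp p q, Etale.of_comp p q⟩

lemma finiteEtale_ι (U : X.Opens) (hU : IsClosed (U : Set X)) : finiteEtale U.ι :=
  have : IsClosedImmersion U.ι := .of_isPreimmersion _ (by simpa using hU)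
  ⟨inferInstance, inferInstance⟩

end FiniteEtale

/-- If every non-empty clopen subset of a space meets a given finite set, then the connected
components of the space are open. -/
lemma isOpen_connectedComponent_of_finite {W : Type*} [TopologicalSpace W] (F : Set W)
    (hF : F.Finite) (h : ∀ C : Set W, IsClopen C → C.Nonempty → (C ∩ F).Nonempty) (x : W) :
    IsOpen (connectedComponent x) := by
  -- `C` is a clopen neighbourhood of `x` with the fewest points of `F`. Splitting off a nonempty
  -- clopen piece would lose a point of `F`, so `C` is connected.
  obtain ⟨C, ⟨hC, hx⟩, hmin⟩ := WellFounded.has_min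
    (measure fun C : Set W => (C ∩ F).ncard).wf {C : Set W | IsClopen C ∧ x ∈ C}
    ⟨Set.univ, isClopen_univ, trivial⟩
  have key : ∀ u v : Set W, IsOpen u → IsOpen v → C ⊆ u ∪ v → C ∩ (u ∩ v) = ∅ → x ∈ u →
      C ⊆ u := by
    intro u v hu hv huv hd hxu
    have h₁ : IsClopen (C ∩ u) := by
      refine ⟨⟨?_⟩, hC.isOpen.inter hu⟩
      have : (C ∩ u)ᶜ = Cᶜ ∪ (C ∩ v) := by
        ext y
        have := Set.ext_iff.1 hd y
        have := @huv y
        simp at *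
        tauto
      rw [this]
      exact hC.compl.isOpen.union (hC.isOpen.inter hv)
    by_contra hne
    obtain ⟨y, hyC, hyu⟩ := Set.not_subset.1 hne
    obtain ⟨z, ⟨hzC, hzu⟩, hzF⟩ := h (C \ (C ∩ u)) (hC.diff h₁) ⟨y, hyC, fun h => hyu h.2⟩
    refine hmin (C ∩ u) ⟨h₁, hx, hxu⟩ (Set.ncard_lt_ncard ?_ (hF.subset Set.inter_subset_right))
    refine ⟨fun t ht => ⟨ht.1.1, ht.2⟩, fun hs => hzu (hs ⟨hzC, hzF⟩).1⟩
  have hpre : IsPreconnected C := by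
    rw [isPreconnected_iff_subset_of_disjoint]
    intro u v hu hv huv hd
    rcases huv hx with hxu | hxv
    · exact Or.inl (key u v hu hv huv hd hxu)
    · exact Or.inr (key v u hv hu (by rwa [Set.union_comm]) (by rwa [Set.inter_comm v]) hxv)
  rw [(hC.connectedComponent_subset hx).antisymm (hpre.subset_connectedComponent hx)]
  exact hC.isOpen

/-- A nonempty clopen subset has clopen image, which is all of the connected base; so it meets the
finite fibre through `x`. -/
lemma isOpen_connectedComponent_of_isFinite_of_etale {X Y : Scheme.{u}} (p : X ⟶ Y) [IsFinite p]
    [Etale p] [ConnectedSpace Y] (x : X) : IsOpen (connectedComponent x) := by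
  refine isOpen_connectedComponent_of_finite (p ⁻¹' {p x}) (p.finite_preimage_singleton _) ?_ x
  intro C hC hne
  have : p '' C = Set.univ := IsClopen.eq_univ
    ⟨p.isClosedMap _ hC.isClosed, p.isOpenMap _ hC.isOpen⟩ (hne.image _)
  obtain ⟨y, hy, hyx⟩ := this.ge (Set.mem_univ (p x))
  exact ⟨y, hy, hyx⟩

/-- Affine étale schemes over a field are reduced. -/
lemma isReduced_Spec_of_etale {A : CommRingCat.{u}} {K : Type u} [Field K]
    (p : Spec A ⟶ Spec (CommRingCat.of K)) (h : Etale p) : IsReduced (Spec A) := by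
  obtain ⟨φ, rfl⟩ := Spec.map_surjective p
  rw [HasRingHomProperty.Spec_iff (P := @Etale)] at h
  algebraize [φ.hom]
  have : _root_.IsReduced A := Algebra.FormallyUnramified.isReduced_of_field K A
  infer_instance

/-- Étale schemes over a field are reduced. -/
lemma isReduced_of_etale_of_isField {X : Scheme.{u}} {K : Type u} [Field K]
    (p : X ⟶ Spec (CommRingCat.of K)) [Etale p] : IsReduced X := by
  have (i : X.affineOpenCover.openCover.I₀) : IsReduced (X.affineOpenCover.openCover.X i) :=
    have : IsOpenImmersion (X.affineOpenCover.f i) :=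
      inferInstanceAs (IsOpenImmersion (X.affineOpenCover.openCover.f i))
    isReduced_Spec_of_etale (A := X.affineOpenCover.X i) (X.affineOpenCover.f i ≫ p) inferInstance
  exact IsReduced.of_openCover _ X.affineOpenCover.openCover

instance geometricallyReduced_of_etale {X Y : Scheme.{u}} (p : X ⟶ Y) [Etale p] :
    GeometricallyReduced p where
  geometrically_isReduced K _ y Z fst snd h :=
    have : Etale snd := MorphismProperty.of_isPullback h ‹_›
    isReduced_of_etale_of_isField snd

/-- Étale schemes over an integral scheme are reduced. -/
lemma isReduced_of_etale_of_isIntegral {X Y : Scheme.{u}} (p : X ⟶ Y) [Etale p] [IsIntegral Y] :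
    IsReduced X := by
  have : Finite (irreducibleComponents Y) := by
    rw [irreducibleComponents_eq_singleton]
    infer_instance
  exact GeometricallyReduced.isReduced_of_flat_of_finite_irreducibleComponents p

/-! ### Galois covers -/

section Galois

variable {P X Y : Scheme.{u}}

lemma aut_left_comp {p : P ⟶ X} (g : Aut (Over.mk p)) : g.hom.left ≫ p = p := Over.w g.hom

/-- The automorphism of `P` over `X` given by two mutually inverse `X`-endomorphisms. -/
def autOfHomInv (p : P ⟶ X) (g h : P ⟶ P) (hg : g ≫ p = p) (hh : h ≫ p = p)
    (hgh : g ≫ h = 𝟙 P) (hhg : h ≫ g = 𝟙 P) : Aut (Over.mk p) where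
  hom := Over.homMk g hg
  inv := Over.homMk h hh
  hom_inv_id := by ext1; exact hgh
  inv_hom_id := by ext1; exact hhg

/-- Two morphisms from a connected scheme to a Galois cover which lie over the same morphism differ
by a unique element of the Galois group. -/
lemma IsGaloisCover.existsUnique_comp_eq {p : P ⟶ X} (hp : IsGaloisCover p) {U : Scheme.{u}}
    [ConnectedSpace U] (a b : U ⟶ P) (h : a ≫ p = b ≫ p) :
    ∃! g : Aut (Over.mk p), a ≫ g.hom.left = b := by
  obtain ⟨⟨_, _⟩, _, _, htr⟩ := hp
  obtain ⟨Ω, _, _, x, -⟩ := exists_geometricPoint U (Classical.arbitrary U)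
  obtain ⟨g, hg⟩ := htr Ω (x ≫ a) (x ≫ b) (by simp only [Category.assoc, h])
  refine ⟨g, ?_, fun g' hg' => ?_⟩
  · refine eq_of_comp_eq_of_connectedSpace p ?_ x (by rw [← Category.assoc, hg])
    rw [Category.assoc, aut_left_comp, h]
  · apply Aut.ext
    ext1
    refine eq_of_comp_eq_of_connectedSpace (U := P) (P := P) p ?_ (x ≫ a) ?_
    · rw [aut_left_comp, aut_left_comp]
    · rw [hg, Category.assoc, hg']

/-- If `g` over `Y` carries `x` to a point with the same image in `X`, then `q` and `g` followed by
`q` agree at `x`. By rigidity over `Y` they are equal, so `g` is already an automorphism over `X`.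
-/
lemma IsGaloisCover.of_comp {q : P ⟶ X} {f : X ⟶ Y} (h : IsGaloisCover (q ≫ f))
    (hf : finiteEtale f) [ConnectedSpace X] : IsGaloisCover q := by
  have hq := finiteEtale_of_comp h.finiteEtale hf
  obtain ⟨_, _⟩ := hq
  obtain ⟨_, _⟩ := hf
  have := h.connected
  refine ⟨⟨inferInstance, inferInstance⟩, surjective_of_isFinite_of_etale q, h.connected, ?_⟩
  intro Ω _ _ x x' hx
  obtain ⟨g, hg⟩ := h.transitive Ω x x' (by rw [← Category.assoc, hx, Category.assoc])
  have h₁ (g : Aut (Over.mk (q ≫ f))) (x x' : Spec (CommRingCat.of Ω) ⟶ P)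
      (hx : x ≫ q = x' ≫ q) (hg : x ≫ g.hom.left = x') : g.hom.left ≫ q = q :=
    eq_of_comp_eq_of_connectedSpace (U := P) f (by simpa using aut_left_comp g) x
      (by rw [← Category.assoc, hg, hx])
  have hinv : x' ≫ g⁻¹.hom.left = x := by
    rw [← hg, Category.assoc]
    exact (congrArg (fun t => x ≫ t) (congrArg CommaMorphism.left g.hom_inv_id)).trans
      (Category.comp_id x)
  exact ⟨autOfHomInv q g.hom.left g⁻¹.hom.left (h₁ g x x' hx hg) (h₁ g⁻¹ x' x hx.symm hinv)
    (congrArg CommaMorphism.left g.hom_inv_id) (congrArg CommaMorphism.left g.inv_hom_id), hg⟩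

end Galois

/-! ### Open connected components -/

section Components

variable {W Y Z T : Scheme.{u}}

lemma IsComponent.isClosed {U : W.Opens} (hU : IsComponent U) : IsClosed (U : Set W) := by
  obtain ⟨x, hx⟩ := hU
  rw [hx]
  exact isClosed_connectedComponent

lemma IsComponent.connectedSpace {U : W.Opens} (hU : IsComponent U) : ConnectedSpace U := by
  obtain ⟨x, hx⟩ := hU
  exact Subtype.connectedSpace (s := (U : Set W)) (hx ▸ isConnected_connectedComponent)

/-- A morphism from a connected scheme which meets a component factors through it. -/
lemma IsComponent.range_subset {U : W.Opens} (hU : IsComponent U) [ConnectedSpace Z] (v : Z ⟶ W)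
    (z : Z) (hz : v z ∈ U) : Set.range v ⊆ Set.range U.ι := by
  obtain ⟨x, hx⟩ := hU
  rw [Scheme.Opens.range_ι, hx]
  have hz' : v z ∈ connectedComponent x := hx ▸ hz
  rw [connectedComponent_eq hz']
  exact (isPreconnected_range v.continuous).subset_connectedComponent ⟨z, rfl⟩

lemma IsComponent.exists_lift {U : W.Opens} (hU : IsComponent U) [ConnectedSpace Z] (v : Z ⟶ W)
    [Nonempty T] (t : T ⟶ Z) (t' : T ⟶ U) (h : t ≫ v = t' ≫ U.ι) :
    ∃ γ : Z ⟶ U, γ ≫ U.ι = v := by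
  obtain ⟨s⟩ := ‹Nonempty T›
  refine ⟨IsOpenImmersion.lift U.ι v (hU.range_subset v (t s) ?_), IsOpenImmersion.lift_fac _ _ _⟩
  rw [← Scheme.Hom.comp_apply, h, Scheme.Hom.comp_apply]
  exact (t' s).2

lemma exists_isComponent (p : W ⟶ Y) (hp : finiteEtale p) [ConnectedSpace Y] (x : W) :
    ∃ U : W.Opens, IsComponent U ∧ x ∈ U := by
  obtain ⟨_, _⟩ := hp
  exact ⟨⟨connectedComponent x, isOpen_connectedComponent_of_isFinite_of_etale p x⟩,
    ⟨x, rfl⟩, mem_connectedComponent⟩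

/-- A component of a finite étale scheme is a Galois cover if any two of its geometric points in
the same fibre are exchanged by an automorphism of the whole scheme. -/
lemma IsComponent.isGaloisCover {U : W.Opens} (hU : IsComponent U) (p : W ⟶ Y)
    (hp : finiteEtale p) [ConnectedSpace Y]
    (h : ∀ (Ω : Type u) [Field Ω] [IsAlgClosed Ω] (x x' : Spec (CommRingCat.of Ω) ⟶ U),
      x ≫ U.ι ≫ p = x' ≫ U.ι ≫ p →
        ∃ g : Aut (Over.mk p), (x ≫ U.ι) ≫ g.hom.left = x' ≫ U.ι) :
    IsGaloisCover (U.ι ≫ p) := by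
  have hfe := finiteEtale_comp (finiteEtale_ι U hU.isClosed) hp
  have := hU.connectedSpace
  refine ⟨hfe, ?_, inferInstance, ?_⟩
  · obtain ⟨_, _⟩ := hfe
    exact surjective_of_isFinite_of_etale _
  intro Ω _ _ x x' hx
  obtain ⟨g, hg⟩ := h Ω x x' hx
  have hgi : g.hom.left ≫ g⁻¹.hom.left = 𝟙 W := congrArg CommaMorphism.left g.hom_inv_id
  have hig : g⁻¹.hom.left ≫ g.hom.left = 𝟙 W := congrArg CommaMorphism.left g.inv_hom_id
  rw [Category.assoc] at hg
  -- `g` and its inverse each send one geometric point of `U` into `U`, hence map the connected `U`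
  -- into itself.
  obtain ⟨γ, hγ⟩ := hU.exists_lift (U.ι ≫ g.hom.left) x x' hg
  obtain ⟨δ, hδ⟩ := hU.exists_lift (U.ι ≫ g⁻¹.hom.left) x' x (by
    rw [← Category.assoc, ← hg, Category.assoc, Category.assoc, hgi, Category.comp_id])
  refine ⟨autOfHomInv (U.ι ≫ p) γ δ ?_ ?_ ?_ ?_, ?_⟩
  · rw [← Category.assoc, hγ, Category.assoc, aut_left_comp]
  · rw [← Category.assoc, hδ, Category.assoc, aut_left_comp]
  · rw [← cancel_mono U.ι, Category.assoc, hδ, ← Category.assoc, hγ, Category.assoc, hgi,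
      Category.comp_id, Category.id_comp]
  · rw [← cancel_mono U.ι, Category.assoc, hγ, ← Category.assoc, hδ, Category.assoc, hig,
      Category.comp_id, Category.id_comp]
  · change x ≫ γ = x'
    rw [← cancel_mono U.ι, Category.assoc, hγ, hg]

end Components

/-! ### Fibre powers, splitting covers and Galois closures -/

/-- Finite fibre powers of a finite étale morphism exist and are finite étale. -/
lemma exists_fibrePower {X Y : Scheme.{u}} (f : X ⟶ Y) (hf : finiteEtale f) (n : ℕ) :
    ∃ (W : Scheme.{u}) (π : W ⟶ Y) (p : Fin n → (W ⟶ X)), finiteEtale π ∧ (∀ i, p i ≫ f = π) ∧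
      ∀ {Z : Scheme.{u}} (t : Z ⟶ Y) (a : Fin n → (Z ⟶ X)), (∀ i, a i ≫ f = t) →
        ∃! v : Z ⟶ W, v ≫ π = t ∧ ∀ i, v ≫ p i = a i := by
  induction n with
  | zero =>
    refine ⟨Y, 𝟙 Y, Fin.elim0, ⟨inferInstance, inferInstance⟩, fun i => i.elim0, ?_⟩
    intro Z t a _
    exact ⟨t, ⟨Category.comp_id t, fun i => i.elim0⟩,
      fun v hv => by rw [← hv.1, Category.comp_id]⟩
  | succ n ih =>
    obtain ⟨W, π, p, hπ, hp, huniv⟩ := ih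
    refine ⟨pullback f π, pullback.snd f π ≫ π,
      Fin.cons (pullback.fst f π) (fun i => pullback.snd f π ≫ p i), ?_, ?_, ?_⟩
    · obtain ⟨_, _⟩ := hf
      exact finiteEtale_comp ⟨inferInstance, inferInstance⟩ hπ
    · intro i
      refine Fin.cases ?_ (fun i => ?_) i
      · simpa using pullback.condition
      · simp [hp]
    · intro Z t a ha
      obtain ⟨v, ⟨hv₁, hv₂⟩, hv₃⟩ := huniv t (fun i => a i.succ) (fun i => ha _)
      refine ⟨pullback.lift (a 0) v (by rw [ha, hv₁]), ⟨?_, ?_⟩, ?_⟩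
      · rw [pullback.lift_snd_assoc, hv₁]
      · intro i
        refine Fin.cases ?_ (fun i => ?_) i
        · simp [pullback.lift_fst]
        · simp [pullback.lift_snd_assoc, hv₂]
      · rintro v' ⟨h₁, h₂⟩
        apply pullback.hom_ext
        · rw [pullback.lift_fst]
          exact h₂ 0
        · rw [pullback.lift_snd]
          refine hv₃ _ ⟨by rw [Category.assoc, h₁], fun i => ?_⟩
          rw [Category.assoc]
          exact h₂ i.succ

variable {P X Y : Scheme.{u}}

/-- A section of a finite étale morphism is both an open and a closed immersion. -/
lemma isOpenImmersion_and_isClosed_range_of_section {p : P ⟶ Y} (hp : finiteEtale p)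
    (s : Y ⟶ P) (hs : s ≫ p = 𝟙 Y) : IsOpenImmersion s ∧ IsClopen (Set.range s) := by
  have h : finiteEtale (s ≫ p) := by
    rw [hs]
    exact ⟨inferInstance, inferInstance⟩
  obtain ⟨_, _⟩ := finiteEtale_of_comp h hp
  have : Mono s := by
    have : Mono (s ≫ p) := by
      rw [hs]
      infer_instance
    exact mono_of_mono s p
  have ho : IsOpenImmersion s := IsOpenImmersion.of_flat_of_mono s
  exact ⟨ho, s.isClosedMap.isClosed_range, s.isOpenEmbedding.isOpen_range⟩

/-- The Galois cover `π : P ⟶ Y` splits `f : X ⟶ Y` completely: the points of `X` with values in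
`P` enumerate the geometric fibres of `f`, and `P` is universal in the sense that a tuple of points
of `X` with values in a connected scheme comes from `P` if it does so at one geometric point. -/
structure IsSplittingCover {n : ℕ} (π : P ⟶ Y) (p : Fin n → (P ⟶ X)) (f : X ⟶ Y) : Prop where
  isGaloisCover : IsGaloisCover π
  comp_eq : ∀ i, p i ≫ f = π
  exists_eq : ∀ (Ω : Type u) [Field Ω] [IsAlgClosed Ω] (z : Spec (CommRingCat.of Ω) ⟶ P)
    (x : Spec (CommRingCat.of Ω) ⟶ X), x ≫ f = z ≫ π → ∃ i, z ≫ p i = x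
  exists_lift : ∀ (Ω : Type u) [Field Ω] [IsAlgClosed Ω] {Z : Scheme.{u}} [ConnectedSpace Z]
    (t : Z ⟶ Y) (a : Fin n → (Z ⟶ X)), (∀ i, a i ≫ f = t) →
    ∀ (z : Spec (CommRingCat.of Ω) ⟶ Z) (z' : Spec (CommRingCat.of Ω) ⟶ P),
      z ≫ t = z' ≫ π → (∀ i, z ≫ a i = z' ≫ p i) → ∃ v : Z ⟶ P, ∀ i, v ≫ p i = a i

/-- Morphisms from a connected `Y`-scheme `U` to `X` which enumerate one geometric fibre of `f`
enumerate all of them. -/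
lemma exists_comp_eq_of_enumerates {f : X ⟶ Y} (hf : finiteEtale f) {ι : Type*} [Finite ι]
    {U : Scheme.{u}} [ConnectedSpace U] (π : U ⟶ Y) (p : ι → (U ⟶ X)) (hp : ∀ i, p i ≫ f = π)
    {Ω : Type u} [Field Ω] [IsAlgClosed Ω] (u : Spec (CommRingCat.of Ω) ⟶ U)
    (hu : ∀ x : Spec (CommRingCat.of Ω) ⟶ X, x ≫ f = u ≫ π → ∃ i, u ≫ p i = x)
    {K : Type u} [Field K] (z : Spec (CommRingCat.of K) ⟶ U)
    (x : Spec (CommRingCat.of K) ⟶ X) (hx : x ≫ f = z ≫ π) : ∃ i, z ≫ p i = x := by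
  let Q := pullback π f
  let q : Q ⟶ U := pullback.fst π f
  have hq : finiteEtale q := by
    obtain ⟨_, _⟩ := hf
    exact ⟨inferInstance, inferInstance⟩
  -- Each `p i` is the graph of a section with clopen image. If these finitely many images missed a
  -- point, their complement would be finite étale and nonempty, hence surjective over `U`; but over
  -- `u` the sections exhaust the fibre.
  let s (i : ι) : U ⟶ Q := pullback.lift (𝟙 U) (p i) (by rw [Category.id_comp, hp])
  have hs₁ (i : ι) : s i ≫ q = 𝟙 U := pullback.lift_fst _ _ _
  have hs₂ (i : ι) : s i ≫ pullback.snd π f = p i := pullback.lift_snd _ _ _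
  have hs (i : ι) := isOpenImmersion_and_isClosed_range_of_section hq (s i) (hs₁ i)
  have hC : IsClopen (⋃ i, Set.range (s i)) := isClopen_iUnion_of_finite fun i => (hs i).2
  have hCuniv : ⋃ i, Set.range (s i) = Set.univ := by
    by_contra hne
    obtain ⟨c, hc⟩ := (Set.ne_univ_iff_exists_notMem _).1 hne
    let C : Q.Opens := ⟨(⋃ i, Set.range (s i))ᶜ, hC.compl.isOpen⟩
    have hCfe : finiteEtale (C.ι ≫ q) := finiteEtale_comp (finiteEtale_ι C hC.compl.isClosed) hq
    have : Nonempty C := ⟨⟨c, hc⟩⟩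
    obtain ⟨_, _⟩ := hCfe
    have := surjective_of_isFinite_of_etale (C.ι ≫ q)
    obtain ⟨w, hw⟩ := exists_lift_geometricPoint (C.ι ≫ q) u
    obtain ⟨i, hi⟩ := hu (w ≫ C.ι ≫ pullback.snd π f) (by
      rw [← hw]
      simp only [Category.assoc]
      rw [← pullback.condition])
    have hwu : w ≫ C.ι = u ≫ s i := by
      apply pullback.hom_ext
      · change (w ≫ C.ι) ≫ q = (u ≫ s i) ≫ q
        rw [Category.assoc, hw, Category.assoc, hs₁, Category.comp_id]
      · rw [Category.assoc, ← hi, Category.assoc, hs₂]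
    let pt : Spec (CommRingCat.of Ω) := IsLocalRing.closedPoint Ω
    refine (w pt).2 (Set.mem_iUnion.2 ⟨i, u pt, ?_⟩)
    change s i (u pt) = C.ι (w pt)
    rw [← Scheme.Hom.comp_apply, ← Scheme.Hom.comp_apply, hwu]
  -- The pair of `z` and `x` is a point of `Q`, so it lies on one of the sections, and its second
  -- coordinate is the value of that `p i`.
  let t : Spec (CommRingCat.of K) ⟶ Q := pullback.lift z x hx.symm
  obtain ⟨i, hi⟩ := Set.mem_iUnion.1 (hCuniv.ge (Set.mem_univ (t (IsLocalRing.closedPoint K))))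
  have := (hs i).1
  have hrange : Set.range t ⊆ Set.range (s i) := by
    rintro _ ⟨y, rfl⟩
    rwa [Subsingleton.elim y (IsLocalRing.closedPoint K)]
  let l := IsOpenImmersion.lift (s i) t hrange
  have hl : l ≫ s i = t := IsOpenImmersion.lift_fac _ _ _
  have hlz : l = z := by
    have : (l ≫ s i) ≫ q = t ≫ q := by rw [hl]
    rwa [Category.assoc, hs₁, Category.comp_id, pullback.lift_fst] at this
  refine ⟨i, ?_⟩
  have : (l ≫ s i) ≫ pullback.snd π f = t ≫ pullback.snd π f := by rw [hl]
  rwa [Category.assoc, hs₂, pullback.lift_snd, hlz] at this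

/-- Splitting covers of finite étale morphisms of connected schemes exist. -/
lemma exists_isSplittingCover {f : X ⟶ Y} (hf : finiteEtale f) [ConnectedSpace X]
    [ConnectedSpace Y] :
    ∃ (n : ℕ) (_ : Nonempty (Fin n)) (P : Scheme.{u}) (π : P ⟶ Y) (p : Fin n → (P ⟶ X)),
      IsSplittingCover π p f := by
  obtain ⟨_, _⟩ := id hf
  have := surjective_of_isFinite_of_etale f
  obtain ⟨Ω, _, _, y, -⟩ := exists_geometricPoint Y (Classical.arbitrary Y)
  have := finite_lifts_geometricPoint f y
  obtain ⟨n, ⟨e⟩⟩ := Finite.exists_equiv_fin {z : Spec (CommRingCat.of Ω) ⟶ X // z ≫ f = y}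
  obtain ⟨W, π, p, hπ, hp, huniv⟩ := exists_fibrePower f hf n
  -- `w` is the point of the fibre power whose coordinates list the fibre over `y`, each element
  -- once.
  obtain ⟨w, ⟨hwπ, hwp⟩, -⟩ := huniv y (fun i => (e.symm i).1) (fun i => (e.symm i).2)
  obtain ⟨U, hU, hwU⟩ := exists_isComponent π hπ (w (IsLocalRing.closedPoint Ω))
  have := hU.connectedSpace
  let u : Spec (CommRingCat.of Ω) ⟶ U := IsOpenImmersion.lift U.ι w
    (hU.range_subset w (IsLocalRing.closedPoint Ω) hwU)
  have hu : u ≫ U.ι = w := IsOpenImmersion.lift_fac _ _ _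
  -- Two coordinates that coincide at one point of `U` coincide on `U`, hence at `w`, where they are
  -- distinct.
  have hinj : ∀ {K : Type u} [Field K] (z : Spec (CommRingCat.of K) ⟶ U) (i j : Fin n),
      z ≫ U.ι ≫ p i = z ≫ U.ι ≫ p j → i = j := by
    intro K _ z i j h
    have h' : U.ι ≫ p i = U.ι ≫ p j :=
      eq_of_comp_eq_of_connectedSpace f (by simp only [Category.assoc, hp]) z h
    have : w ≫ p i = w ≫ p j := by
      rw [← hu, Category.assoc, h', Category.assoc]
    rw [hwp, hwp] at this
    exact e.symm.injective (Subtype.ext this)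
  have hex : ∀ (K : Type u) [Field K] [IsAlgClosed K] (z : Spec (CommRingCat.of K) ⟶ U)
      (x : Spec (CommRingCat.of K) ⟶ X), x ≫ f = z ≫ U.ι ≫ π → ∃ i, z ≫ U.ι ≫ p i = x := by
    intro K _ _ z x hx
    refine exists_comp_eq_of_enumerates hf (U.ι ≫ π) (fun i => U.ι ≫ p i)
      (fun i => by rw [Category.assoc, hp]) u ?_ z x hx
    intro x hx
    rw [← Category.assoc, hu, hwπ] at hx
    refine ⟨e ⟨x, hx⟩, ?_⟩
    rw [← Category.assoc, hu, hwp, Equiv.symm_apply_apply]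
  have hgal : IsGaloisCover (U.ι ≫ π) := by
    refine hU.isGaloisCover π hπ fun K _ _ z z' hz => ?_
    -- The coordinates of `z'` are those of `z`, reindexed by an injective self-map of `Fin n`, that
    -- is, by a permutation.
    choose s hs using fun i => hex K z (z' ≫ U.ι ≫ p i) (by
      simp only [Category.assoc, hp]
      exact hz.symm)
    have hsinj : Function.Injective s := fun i j hij => hinj z' i j (by rw [← hs, ← hs, hij])
    let σ : Equiv.Perm (Fin n) := Equiv.ofBijective s (Finite.injective_iff_bijective.1 hsinj)
    have hg (τ : Equiv.Perm (Fin n)) := (huniv π (fun i => p (τ i)) (fun i => hp _)).exists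
    choose g hg₁ hg₂ using hg
    have hcomp (τ : Equiv.Perm (Fin n)) : g τ ≫ g τ⁻¹ = 𝟙 W := by
      refine (huniv π p hp).unique ⟨?_, fun i => ?_⟩ ⟨Category.id_comp _, fun i => Category.id_comp _⟩
      · rw [Category.assoc, hg₁, hg₁]
      · rw [Category.assoc, hg₂, hg₂, ← Equiv.Perm.mul_apply, mul_inv_cancel, Equiv.Perm.one_apply]
    refine ⟨autOfHomInv π (g σ) (g σ⁻¹) (hg₁ _) (hg₁ _) (hcomp σ) ?_, ?_⟩
    · simpa using hcomp σ⁻¹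
    · change (z ≫ U.ι) ≫ g σ = z' ≫ U.ι
      refine (huniv (z' ≫ U.ι ≫ π) (fun i => z' ≫ U.ι ≫ p i)
        (fun i => by simp only [Category.assoc, hp])).unique ⟨?_, fun i => ?_⟩ ⟨?_, fun i => ?_⟩
      · rw [Category.assoc, hg₁, Category.assoc, hz]
      · rw [Category.assoc, hg₂, Category.assoc]
        exact hs i
      · rw [Category.assoc]
      · rw [Category.assoc]
  refine ⟨n, ?_, U, U.ι ≫ π, fun i => U.ι ≫ p i, hgal, fun i => by rw [Category.assoc, hp], hex, ?_⟩
  · obtain ⟨x, hx⟩ := exists_lift_geometricPoint f y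
    exact ⟨e ⟨x, hx⟩⟩
  · intro K _ _ Z _ t a ha z z' hzt hza
    obtain ⟨v, ⟨hv₁, hv₂⟩, -⟩ := huniv t a ha
    have hzv : z ≫ v = z' ≫ U.ι := by
      refine (huniv (z ≫ t) (fun i => z ≫ a i) (fun i => by rw [Category.assoc, ha])).unique
        ⟨by rw [Category.assoc, hv₁], fun i => by rw [Category.assoc, hv₂]⟩
        ⟨by rw [Category.assoc, hzt], fun i => by rw [Category.assoc, hza]⟩
    obtain ⟨γ, hγ⟩ := hU.exists_lift v z z' hzv
    exact ⟨γ, fun i => by rw [← Category.assoc, hγ, hv₂]⟩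

/-- A Galois cover of a base change of `Y` which dominates the base change of `X` maps to any
splitting cover of `X ⟶ Y`. -/
lemma IsSplittingCover.exists_lift_of_isPullback {n : ℕ} {π : P ⟶ Y} {p : Fin n → (P ⟶ X)}
    {f : X ⟶ Y} (h : IsSplittingCover π p f) (i₀ : Fin n) {X' Y' Z : Scheme.{u}} {g' : X' ⟶ X}
    {f' : X' ⟶ Y'} {g : Y' ⟶ Y} (sq : IsPullback g' f' f g) (hf' : finiteEtale f')
    [ConnectedSpace X'] (q : Z ⟶ X') (hq : IsGaloisCover (q ≫ f')) :
    ∃ v : Z ⟶ P, v ≫ p i₀ = q ≫ g' := by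
  have hqfe := finiteEtale_of_comp hq.finiteEtale hf'
  obtain ⟨_, _⟩ := hqfe
  obtain ⟨_, _⟩ := hf'
  have := hq.connected
  have := surjective_of_isFinite_of_etale q
  have := h.isGaloisCover.surjective
  obtain ⟨_, _⟩ := h.isGaloisCover.finiteEtale
  obtain ⟨_, _⟩ := hq.finiteEtale
  obtain ⟨Ω, _, _, z₀, -⟩ := exists_geometricPoint Z (Classical.arbitrary Z)
  obtain ⟨z', hz'⟩ := exists_lift_geometricPoint π (z₀ ≫ q ≫ f' ≫ g)
  -- The fibre of `X'` over the image of `z₀` in `Y'` is the fibre of `X` over its image in `Y`,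
  -- which the `z' ≫ p i` enumerate. The `z i` are points of `Z` above these, all in one fibre over
  -- `Y'`.
  have hz (i : Fin n) : ∃ z : Spec (CommRingCat.of Ω) ⟶ Z, z ≫ q ≫ g' = z' ≫ p i ∧
      z ≫ q ≫ f' = z₀ ≫ q ≫ f' := by
    obtain ⟨z, hz⟩ := exists_lift_geometricPoint q
      (sq.lift (z' ≫ p i) (z₀ ≫ q ≫ f') (by simp only [Category.assoc, h.comp_eq, hz']))
    exact ⟨z, by rw [← Category.assoc, hz, sq.lift_fst], by rw [← Category.assoc, hz, sq.lift_snd]⟩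
  choose z hz₁ hz₂ using hz
  choose a ha using fun i => hq.transitive Ω (z i₀) (z i) (by rw [hz₂, hz₂])
  have haq (i : Fin n) : (a i).hom.left ≫ q ≫ f' = q ≫ f' := aut_left_comp (a i)
  -- `a i₀` fixes the point `z i₀`, so it is the identity; this makes the coordinate `i₀` of `v` the
  -- given morphism.
  have hai₀ : (a i₀).hom.left = 𝟙 Z :=
    eq_of_comp_eq_of_connectedSpace (U := Z) (P := Z) (q ≫ f')
      (by rw [haq, Category.id_comp]) (z i₀) (by rw [ha, Category.comp_id])
  obtain ⟨v, hv⟩ := h.exists_lift Ω (q ≫ f' ≫ g) (fun i => (a i).hom.left ≫ q ≫ g') (fun i => by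
      have := haq i
      simp only [Category.assoc, sq.w]
      simp only [← Category.assoc] at this ⊢
      rw [this]) (z i₀) z' (by
      have := hz₂ i₀
      rw [hz']
      simp only [← Category.assoc] at this ⊢
      rw [this]) (fun i => by rw [← Category.assoc, ha, hz₁])
  exact ⟨v, by rw [hv, hai₀, Category.id_comp]⟩

/-- Domination is the case of the trivial base change. -/
lemma IsSplittingCover.isGaloisClosure {n : ℕ} {π : P ⟶ Y} {p : Fin n → (P ⟶ X)}
    {f : X ⟶ Y} (h : IsSplittingCover π p f) (hf : finiteEtale f) [ConnectedSpace X]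
    (i : Fin n) : IsGaloisClosure (p i) f where
  isGaloisCover := by
    rw [h.comp_eq]
    exact h.isGaloisCover
  dominated q hq := by
    obtain ⟨v, hv⟩ := h.exists_lift_of_isPullback i (IsPullback.of_horiz_isIso ⟨by simp⟩ :
      IsPullback (𝟙 X) f f (𝟙 Y)) hf q hq
    exact ⟨v, by rw [hv, Category.comp_id]⟩

/-- Galois closures of finite étale morphisms of connected schemes exist. -/
lemma exists_isGaloisClosure {f : X ⟶ Y} (hf : finiteEtale f) [ConnectedSpace X]
    [ConnectedSpace Y] : ∃ (P : Scheme.{u}) (q : P ⟶ X), IsGaloisClosure q f := by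
  obtain ⟨n, ⟨i⟩, P, π, p, h⟩ := exists_isSplittingCover hf
  exact ⟨P, p i, h.isGaloisClosure hf i⟩

/-- A Galois closure of a base change of `f` maps to any Galois closure of `f`. -/
lemma IsGaloisClosure.exists_comp_eq_of_isPullback {f : X ⟶ Y} (hf : finiteEtale f)
    [ConnectedSpace X] [ConnectedSpace Y] {q : P ⟶ X} (hq : IsGaloisClosure q f)
    {X' Y' Z : Scheme.{u}} {g' : X' ⟶ X} {f' : X' ⟶ Y'} {g : Y' ⟶ Y}
    (sq : IsPullback g' f' f g) (hf' : finiteEtale f') [ConnectedSpace X'] (q' : Z ⟶ X')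
    (hq' : IsGaloisCover (q' ≫ f')) : ∃ c : Z ⟶ P, c ≫ q = q' ≫ g' := by
  -- The given closure need not be a splitting cover, but the splitting cover is Galois and
  -- dominates `X`, so it maps to `P`.
  obtain ⟨n, ⟨i⟩, P', π, p, h⟩ := exists_isSplittingCover hf
  obtain ⟨v, hv⟩ := h.exists_lift_of_isPullback i sq hf' q' hq'
  obtain ⟨w, hw⟩ := hq.dominated (p i) (h.isGaloisClosure hf i).isGaloisCover
  exact ⟨v ≫ w, by rw [Category.assoc, hw, hv]⟩

lemma IsAlgebraicVariety.comp_of_finiteEtale {Z X S : Scheme.{u}} {s : X ⟶ S}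
    (hs : IsAlgebraicVariety s) [IsIntegral X] {p : Z ⟶ X} (hp : finiteEtale p) :
    IsAlgebraicVariety (p ≫ s) := by
  obtain ⟨_, _⟩ := hp
  obtain ⟨_, _, _, _⟩ := hs
  exact ⟨isReduced_of_etale_of_isIntegral p, inferInstance, inferInstance, inferInstance⟩

/-- `τ` and its composite with `g` have the same image in `X`, so they differ by a unique Galois
element; uniqueness makes the assignment multiplicative. It serves for `π₁` and for every twisted
morphism. -/
lemma IsGaloisCover.exists_monoidHom {P X Z W : Scheme.{u}} {p : P ⟶ X} (hp : IsGaloisCover p)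
    [ConnectedSpace Z] (q : Z ⟶ W) (τ : Z ⟶ P) (ρ : W ⟶ X) (hτ : τ ≫ p = q ≫ ρ) :
    ∃ φ : Aut (Over.mk q) →* Aut (Over.mk p), ∀ g, g.hom.left ≫ τ = τ ≫ (φ g).hom.left := by
  have key (g : Aut (Over.mk q)) := hp.existsUnique_comp_eq τ (g.hom.left ≫ τ) (by
    rw [Category.assoc, hτ, ← Category.assoc, aut_left_comp])
  choose φ hφ hφ' using key
  refine ⟨MonoidHom.mk' φ fun g h => (hφ' _ _ ?_).symm, fun g => (hφ g).symm⟩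
  have h₁ : (g * h).hom.left = h.hom.left ≫ g.hom.left := rfl
  have h₂ : (φ g * φ h).hom.left = (φ h).hom.left ≫ (φ g).hom.left := rfl
  change τ ≫ (φ g * φ h).hom.left = (g * h).hom.left ≫ τ
  rw [h₁, h₂, ← Category.assoc, hφ]
  change (h.hom.left ≫ τ) ≫ (φ g).hom.left = _
  rw [Category.assoc, hφ]
  exact (Category.assoc _ _ _).symm

end AlgebraicGeometry

namespace TwistedDiagram

variable {R : Type u} [CommRing R] {ς : R →+* R}

/-! ### The fibre products `A` and `B` and their components -/

section FibreProd

variable (X : TwistedDiagram.{u} ς) (s : X.Idx) {P₀ P' Z : Scheme.{u}} {a : P₀ ⟶ X.X₀}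
  {a' : P' ⟶ X.twist}

lemma fibreProd_hom_ext {v w : Z ⟶ X.fibreProd s a a'}
    (h₀ : v ≫ X.fibreProdFst s a a' = w ≫ X.fibreProdFst s a a')
    (h' : v ≫ X.fibreProdSnd s a a' = w ≫ X.fibreProdSnd s a a')
    (h₁ : v ≫ X.fibreProdBase s a a' = w ≫ X.fibreProdBase s a a') : v = w := by
  apply pullback.hom_ext
  · apply pullback.hom_ext
    · exact (Category.assoc _ _ _).trans (h₀.trans (Category.assoc _ _ _).symm)
    · exact (Category.assoc _ _ _).trans (h'.trans (Category.assoc _ _ _).symm)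
  · exact h₁

lemma exists_fibreProd_lift (v₀ : Z ⟶ P₀) (v' : Z ⟶ P') (v₁ : Z ⟶ X.X₁)
    (h₀ : v₀ ≫ a = v₁ ≫ X.π₁) (h' : v' ≫ a' = v₁ ≫ X.π₂ s) :
    ∃ v : Z ⟶ X.fibreProd s a a', v ≫ X.fibreProdFst s a a' = v₀ ∧
      v ≫ X.fibreProdSnd s a a' = v' ∧ v ≫ X.fibreProdBase s a a' = v₁ := by
  have hv : v₀ ≫ a ≫ X.str₀ = v' ≫ a' ≫ X.twistStr := by
    rw [← Category.assoc, h₀, ← Category.assoc, h', Category.assoc, Category.assoc, X.π₁_str,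
      X.π₂_twistStr]
  have hw : pullback.lift v₀ v' hv ≫ X.prodMap a a' = v₁ ≫ X.corr s := by
    apply pullback.hom_ext
    · simp only [prodMap, corr, Category.assoc, pullback.lift_fst, pullback.lift_fst_assoc, h₀]
    · simp only [prodMap, corr, Category.assoc, pullback.lift_snd, pullback.lift_snd_assoc, h']
  refine ⟨pullback.lift (pullback.lift v₀ v' hv) v₁ hw, ?_, ?_, pullback.lift_snd _ _ _⟩
  · exact (pullback.lift_fst_assoc _ _ _ _).trans (pullback.lift_fst _ _ _)
  · exact (pullback.lift_fst_assoc _ _ _ _).trans (pullback.lift_snd _ _ _)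

/-- Properties of `a` and `a'` are inherited by the projection of the fibre product to `X₁`. -/
lemma fibreProdBase_mem (Q : MorphismProperty Scheme.{u}) [Q.IsStableUnderBaseChange]
    [Q.IsStableUnderComposition] (ha : Q a) (ha' : Q a') : Q (X.fibreProdBase s a a') :=
  MorphismProperty.pullback_snd _ _
    (MorphismProperty.pullbackMap (P := Q) (f := a ≫ X.str₀) (g := a' ≫ X.twistStr) ha ha' rfl rfl)

lemma finiteEtale_fibreProdBase (ha : finiteEtale a) (ha' : finiteEtale a') :
    finiteEtale (X.fibreProdBase s a a') := by
  have : MorphismProperty.IsStableUnderComposition (C := Scheme.{u}) @Etale :=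
    ⟨fun f g hf hg => @Etale.etale_comp _ _ f _ g hf hg⟩
  exact ⟨X.fibreProdBase_mem s @IsFinite ha.1 ha'.1, X.fibreProdBase_mem s @Etale ha.2 ha'.2⟩

lemma surjective_fibreProdBase (ha : Surjective a) (ha' : Surjective a') :
    Surjective (X.fibreProdBase s a a') := by
  have : MorphismProperty.IsStableUnderComposition (C := Scheme.{u}) @Surjective :=
    ⟨fun f g hf hg => ⟨by
      rw [Scheme.Hom.comp_base, TopCat.coe_comp]
      exact hg.surj.comp hf.surj⟩⟩
  exact X.fibreProdBase_mem s @Surjective ha ha'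

/-- Automorphisms of `P₀` and `P'` induce an endomorphism of the fibre product. -/
lemma exists_fibreProd_map (g₀ : P₀ ⟶ P₀) (g' : P' ⟶ P') (h₀ : g₀ ≫ a = a) (h' : g' ≫ a' = a') :
    ∃ v : X.fibreProd s a a' ⟶ X.fibreProd s a a',
      v ≫ X.fibreProdFst s a a' = X.fibreProdFst s a a' ≫ g₀ ∧
      v ≫ X.fibreProdSnd s a a' = X.fibreProdSnd s a a' ≫ g' ∧
      v ≫ X.fibreProdBase s a a' = X.fibreProdBase s a a' :=
  X.exists_fibreProd_lift s _ _ _ (by rw [Category.assoc, h₀, fibreProd_fst_comm])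
    (by rw [Category.assoc, h', fibreProd_snd_comm])

/-- The components of the fibre product of two Galois covers are Galois covers. -/
lemma isGaloisCover_fibreProd_component [ConnectedSpace X.X₁] (ha : IsGaloisCover a)
    (ha' : IsGaloisCover a') {U : (X.fibreProd s a a').Opens} (hU : IsComponent U) :
    IsGaloisCover (U.ι ≫ X.fibreProdBase s a a') := by
  refine hU.isGaloisCover _ (X.finiteEtale_fibreProdBase s ha.finiteEtale ha'.finiteEtale)
    fun Ω _ _ x x' hx => ?_
  simp only [← Category.assoc] at hx
  -- `x` and `x'` have the same image in `X₁`, so their coordinates in `P₀` and in `P'` lie in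
  -- common fibres of `a` and `a'`. The pair of `g₀` and `g'` moves `x` to `x'`.
  obtain ⟨g₀, hg₀⟩ := ha.transitive Ω ((x ≫ U.ι) ≫ X.fibreProdFst s a a')
    ((x' ≫ U.ι) ≫ X.fibreProdFst s a a') (by
      rw [Category.assoc, Category.assoc _ _ a, fibreProd_fst_comm, ← Category.assoc, hx,
        Category.assoc])
  obtain ⟨g', hg'⟩ := ha'.transitive Ω ((x ≫ U.ι) ≫ X.fibreProdSnd s a a')
    ((x' ≫ U.ι) ≫ X.fibreProdSnd s a a') (by
      rw [Category.assoc, Category.assoc _ _ a', fibreProd_snd_comm, ← Category.assoc, hx,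
        Category.assoc])
  obtain ⟨v, hv₀, hv', hv₁⟩ := X.exists_fibreProd_map s g₀.hom.left g'.hom.left
    (aut_left_comp g₀) (aut_left_comp g')
  obtain ⟨w, hw₀, hw', hw₁⟩ := X.exists_fibreProd_map s g₀⁻¹.hom.left g'⁻¹.hom.left
    (aut_left_comp g₀⁻¹) (aut_left_comp g'⁻¹)
  have e₁ : g₀.hom.left ≫ g₀⁻¹.hom.left = 𝟙 P₀ := congrArg CommaMorphism.left g₀.hom_inv_id
  have e₂ : g₀⁻¹.hom.left ≫ g₀.hom.left = 𝟙 P₀ := congrArg CommaMorphism.left g₀.inv_hom_id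
  have e₃ : g'.hom.left ≫ g'⁻¹.hom.left = 𝟙 P' := congrArg CommaMorphism.left g'.hom_inv_id
  have e₄ : g'⁻¹.hom.left ≫ g'.hom.left = 𝟙 P' := congrArg CommaMorphism.left g'.inv_hom_id
  refine ⟨autOfHomInv _ v w hv₁ hw₁ ?_ ?_, ?_⟩
  · apply fibreProd_hom_ext
    · rw [Category.assoc, hw₀, ← Category.assoc, hv₀, Category.assoc, e₁]
      exact (Category.comp_id _).trans (Category.id_comp _).symm
    · rw [Category.assoc, hw', ← Category.assoc, hv', Category.assoc, e₃]
      exact (Category.comp_id _).trans (Category.id_comp _).symm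
    · rw [Category.assoc, hw₁, hv₁, Category.id_comp]
  · apply fibreProd_hom_ext
    · rw [Category.assoc, hv₀, ← Category.assoc, hw₀, Category.assoc, e₂]
      exact (Category.comp_id _).trans (Category.id_comp _).symm
    · rw [Category.assoc, hv', ← Category.assoc, hw', Category.assoc, e₄]
      exact (Category.comp_id _).trans (Category.id_comp _).symm
    · rw [Category.assoc, hv₁, hw₁, Category.id_comp]
  · change (x ≫ U.ι) ≫ v = x' ≫ U.ι
    apply fibreProd_hom_ext
    · rw [Category.assoc, hv₀, ← Category.assoc, hg₀]
    · rw [Category.assoc, hv', ← Category.assoc, hg']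
    · rw [Category.assoc, hv₁, hx]

end FibreProd

/-- The twisted morphisms form a single orbit by construction and `Y` has a single index, so the
orbit condition is automatic. Integrality of the bases makes the étale covers reduced, hence
varieties. -/
lemma isAlmostDirectGaloisCover_orbitMap (Y : TwistedDiagram.{u} ς) [Unique Y.Idx] (t : Y.Idx)
    (hY : Y.IsAlmostDirectPresentation) [IsIntegral Y.X₀] [IsIntegral Y.X₁] {Z₀ Z₁ : Scheme.{u}}
    {p₀ : Z₀ ⟶ Y.X₀} {p₁ : Z₁ ⟶ Y.X₁} {ϖ τ : Z₁ ⟶ Z₀} (hϖ : ϖ ≫ p₀ = p₁ ≫ Y.π₁)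
    (hτ : τ ≫ p₀ = p₁ ≫ Y.σ t) (h₀ : IsGaloisCover p₀) (h₁ : IsGaloisCover p₁) :
    IsAlmostDirectGaloisCover (Y.orbitMap t p₀ p₁ ϖ τ hϖ hτ) where
  source := ⟨hY.variety₀.comp_of_finiteEtale h₀.finiteEtale,
    hY.variety₁.comp_of_finiteEtale h₁.finiteEtale⟩
  target := hY
  galois₀ := h₀
  galois₁ := h₁
  action := by
    let act : MulAction (Aut (Over.mk p₀))
        {ρ : Z₁ ⟶ Z₀ // ∃ g : Aut (Over.mk p₀), ρ = τ ≫ g.hom.left} :=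
      { smul := fun g ρ => ⟨ρ.1 ≫ g.hom.left, by
          obtain ⟨ρ, h, rfl⟩ := ρ
          exact ⟨g * h, Category.assoc _ _ _⟩⟩
        one_smul := fun ρ => Subtype.ext (Category.comp_id ρ.1)
        mul_smul := fun g h ρ =>
          Subtype.ext (Category.assoc ρ.1 h.hom.left g.hom.left).symm }
    refine ⟨act, fun _ _ => rfl, fun y => ⟨⟨τ, 1, (Category.comp_id τ).symm⟩,
      Subsingleton.elim _ _⟩, ?_⟩
    rintro ⟨ρ, g, rfl⟩ ⟨ρ', g', rfl⟩
    refine ⟨fun _ => ⟨g' * g⁻¹, Subtype.ext ?_⟩, fun _ => rfl⟩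
    change (τ ≫ g.hom.left) ≫ (g' * g⁻¹).hom.left = τ ≫ g'.hom.left
    have : g.hom.left ≫ (g' * g⁻¹).hom.left = g'.hom.left := by
      change ((g' * g⁻¹) * g).hom.left = g'.hom.left
      rw [inv_mul_cancel_right]
    rw [Category.assoc, this]
  hom_π₁ :=
    have := h₁.connected
    h₀.exists_monoidHom p₁ ϖ Y.π₁ hϖ
  hom_σ := by
    have := h₁.connected
    rintro ⟨ρ, g, rfl⟩
    refine h₀.exists_monoidHom p₁ (τ ≫ g.hom.left) (Y.σ t) ?_
    rw [Category.assoc, aut_left_comp, hτ]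

/-- By the pasting law, since both twists are base changes along the same morphism. This lets the
comparison `c` be built from the base change of `f₀`. -/
lemma isPullback_twist {X Y : TwistedDiagram.{u} ς} (f : X ⟶ Y) :
    IsPullback X.twistProj (Hom.twist f) f.f₀ Y.twistProj := by
  have h : IsPullback Y.twistProj Y.twistStr Y.str₀ (Spec.map (CommRingCat.ofHom ς)) :=
    IsPullback.of_hasPullback _ _
  have h' : IsPullback X.twistProj X.twistStr X.str₀ (Spec.map (CommRingCat.ofHom ς)) :=
    IsPullback.of_hasPullback _ _
  refine IsPullback.of_bot ?_ (Hom.twist_twistProj f).symm h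
  rwa [Hom.twist_twistStr, f.f₀_str]

/-! ### Functoriality in `f` -/

section FibreProdMap

variable {X Y : TwistedDiagram.{u} ς} (f : X ⟶ Y) (s : X.Idx) {P₀ P' : Scheme.{u}}
  (a : P₀ ⟶ X.X₀) (a' : P' ⟶ X.twist)

lemma fibreProdMap_fst : fibreProdMap f s a a' ≫
    Y.fibreProdFst (f.idx s) (a ≫ f.f₀) (a' ≫ Hom.twist f) = X.fibreProdFst s a a' :=
  (pullback.lift_fst_assoc _ _ _ _).trans (pullback.lift_fst _ _ _)

lemma fibreProdMap_snd : fibreProdMap f s a a' ≫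
    Y.fibreProdSnd (f.idx s) (a ≫ f.f₀) (a' ≫ Hom.twist f) = X.fibreProdSnd s a a' :=
  (pullback.lift_fst_assoc _ _ _ _).trans (pullback.lift_snd _ _ _)

lemma fibreProdMap_base : fibreProdMap f s a a' ≫
    Y.fibreProdBase (f.idx s) (a ≫ f.f₀) (a' ≫ Hom.twist f) =
      X.fibreProdBase s a a' ≫ f.f₁ :=
  pullback.lift_snd _ _ _

lemma resLE_base (U : (X.fibreProd s a a').Opens)
    (V : (Y.fibreProd (f.idx s) (a ≫ f.f₀) (a' ≫ Hom.twist f)).Opens)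
    (hUV : U ≤ fibreProdMap f s a a' ⁻¹ᵁ V) :
    (fibreProdMap f s a a').resLE V U hUV ≫
        V.ι ≫ Y.fibreProdBase (f.idx s) (a ≫ f.f₀) (a' ≫ Hom.twist f) =
      (U.ι ≫ X.fibreProdBase s a a') ≫ f.f₁ := by
  rw [← Category.assoc, Scheme.Hom.resLE_comp_ι, Category.assoc, fibreProdMap_base, Category.assoc]

/-- The morphism between the objects attached to open subschemes of the fibre products. -/
lemma exists_closureObj_hom (c : P' ⟶ P₀) (hc : c ≫ a = a' ≫ X.twistProj)
    (U : (X.fibreProd s a a').Opens)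
    (V : (Y.fibreProd (f.idx s) (a ≫ f.f₀) (a' ≫ Hom.twist f)).Opens)
    (hUV : U ≤ fibreProdMap f s a a' ⁻¹ᵁ V) :
    ∃ j : X.closureObj s a a' c hc U ⟶
        Y.closureObj (f.idx s) (a ≫ f.f₀) (a' ≫ Hom.twist f) c (comparison_comp f hc) V,
      j.f₀ = 𝟙 P₀ ∧ j.f₁ = (fibreProdMap f s a a').resLE V U hUV := by
  let r := (fibreProdMap f s a a').resLE V U hUV
  have hr : r ≫ V.ι = U.ι ≫ fibreProdMap f s a a' := Scheme.Hom.resLE_comp_ι _ _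
  have hr₀ : r ≫ V.ι ≫ Y.fibreProdFst (f.idx s) (a ≫ f.f₀) (a' ≫ Hom.twist f) =
      U.ι ≫ X.fibreProdFst s a a' := by
    rw [← Category.assoc, hr, Category.assoc, fibreProdMap_fst]
  have hr' : r ≫ V.ι ≫ Y.fibreProdSnd (f.idx s) (a ≫ f.f₀) (a' ≫ Hom.twist f) ≫ c =
      U.ι ≫ X.fibreProdSnd s a a' ≫ c := by
    rw [← Category.assoc, hr, Category.assoc, ← Category.assoc (fibreProdMap f s a a'),
      fibreProdMap_snd]
  -- The Galois group over `X₀` sits inside the one over `Y₀`, so the orbit of twisted morphisms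
  -- over `X` is induced from the orbit over `Y`.
  have hg (g : Aut (Over.mk a)) : ∃ g' : Aut (Over.mk (a ≫ f.f₀)), g'.hom.left = g.hom.left :=
    ⟨autOfHomInv (a ≫ f.f₀) g.hom.left g⁻¹.hom.left
      (by rw [← Category.assoc, aut_left_comp]) (by rw [← Category.assoc, aut_left_comp])
      (congrArg CommaMorphism.left g.hom_inv_id) (congrArg CommaMorphism.left g.inv_hom_id), rfl⟩
  have hidx (ρ : (X.closureObj s a a' c hc U).Idx) :
      ∃ ρ' : (Y.closureObj (f.idx s) (a ≫ f.f₀) (a' ≫ Hom.twist f) c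
        (comparison_comp f hc) V).Idx, ρ.1 = r ≫ ρ'.1 := by
    obtain ⟨ρ, g, rfl⟩ := ρ
    obtain ⟨g', hg'⟩ := hg g
    refine ⟨⟨_, g', rfl⟩, ?_⟩
    change (U.ι ≫ X.fibreProdSnd s a a' ≫ c) ≫ g.hom.left = r ≫ (V.ι ≫ Y.fibreProdSnd (f.idx s)
      (a ≫ f.f₀) (a' ≫ Hom.twist f) ≫ c) ≫ g'.hom.left
    rw [hg', ← hr']
    simp only [Category.assoc]
  choose idx hidx using hidx
  refine ⟨⟨idx, 𝟙 P₀, r, ?_, ?_, ?_, ?_⟩, rfl, rfl⟩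
  · change 𝟙 P₀ ≫ (a ≫ f.f₀) ≫ Y.str₀ = a ≫ X.str₀
    rw [Category.id_comp, Category.assoc, f.f₀_str]
  · change r ≫ (V.ι ≫ Y.fibreProdBase (f.idx s) (a ≫ f.f₀) (a' ≫ Hom.twist f)) ≫ Y.str₁ =
      (U.ι ≫ X.fibreProdBase s a a') ≫ X.str₁
    rw [← Category.assoc, resLE_base, Category.assoc, f.f₁_str]
  · exact (Category.comp_id _).trans hr₀.symm
  · exact fun ρ => (Category.comp_id _).trans (hidx ρ)

end FibreProdMap

end TwistedDiagram

/-! ### The direct Galois closure -/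

theorem mainTheorem9 {R : Type u} [CommRing R] [IsDomain R] (ς : R →+* R)
    (hς : Function.Injective ς) (X Y : TwistedDiagram.{u} ς) [Unique X.Idx] [Unique Y.Idx]
    (hX : X.IsAlmostDirectPresentation) (hY : Y.IsAlmostDirectPresentation)
    (hXint : X.IsDirectly IsIntegral) (hYint : Y.IsDirectly IsIntegral)
    (f : X ⟶ Y) (hf : TwistedDiagram.Hom.IsDirectly finiteEtale f) :
    (∃ (P₀ : Scheme.{u}) (q : P₀ ⟶ X.X₀), IsGaloisClosure q f.f₀) ∧
    (∃ (P' : Scheme.{u}) (q' : P' ⟶ X.twist), IsGaloisClosure q' (TwistedDiagram.Hom.twist f)) ∧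
    ∀ (P₀ P' : Scheme.{u}) (q : P₀ ⟶ X.X₀) (q' : P' ⟶ X.twist),
      IsGaloisClosure q f.f₀ → IsGaloisClosure q' (TwistedDiagram.Hom.twist f) →
      (∃ U : (X.fibreProd default q q').Opens, IsComponent U) ∧
      (∀ U : (X.fibreProd default q q').Opens, IsComponent U →
        ∃ V : (Y.fibreProd (f.idx default) (q ≫ f.f₀) (q' ≫ TwistedDiagram.Hom.twist f)).Opens,
          IsComponent V ∧ U ≤ TwistedDiagram.fibreProdMap f default q q' ⁻¹ᵁ V) ∧
      (∃ c : P' ⟶ P₀, c ≫ q = q' ≫ X.twistProj) ∧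
      ∀ (c : P' ⟶ P₀) (hc : c ≫ q = q' ≫ X.twistProj)
        (U : (X.fibreProd default q q').Opens)
        (V : (Y.fibreProd (f.idx default) (q ≫ f.f₀) (q' ≫ TwistedDiagram.Hom.twist f)).Opens)
        (hUV : U ≤ TwistedDiagram.fibreProdMap f default q q' ⁻¹ᵁ V),
        IsComponent U → IsComponent V →
        TwistedDiagram.IsAlmostDirectGaloisCover (X.closureMap default q q' c hc U) ∧
        TwistedDiagram.IsAlmostDirectGaloisCover
          (Y.closureMap (f.idx default) (q ≫ f.f₀) (q' ≫ TwistedDiagram.Hom.twist f) c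
            (TwistedDiagram.comparison_comp f hc) V) ∧
        ∃ j : X.closureObj default q q' c hc U ⟶
            Y.closureObj (f.idx default) (q ≫ f.f₀) (q' ≫ TwistedDiagram.Hom.twist f) c
              (TwistedDiagram.comparison_comp f hc) V,
          j.f₀ = 𝟙 P₀ ∧ j.f₁ = (TwistedDiagram.fibreProdMap f default q q').resLE V U hUV ∧
          j ≫ Y.closureMap (f.idx default) (q ≫ f.f₀) (q' ≫ TwistedDiagram.Hom.twist f) c
              (TwistedDiagram.comparison_comp f hc) V =
            X.closureMap default q q' c hc U ≫ f := by

  obtain ⟨_, _, _⟩ := hXint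
  obtain ⟨_, _, _⟩ := hYint
  obtain ⟨hf₀, hf₁, hf'⟩ := hf
  refine ⟨exists_isGaloisClosure hf₀, exists_isGaloisClosure hf', ?_⟩
  intro P₀ P' q q' hq hq'
  have hG₀ := hq.isGaloisCover
  have hG' := hq'.isGaloisCover
  -- The closures are Galois over the intermediate `X₀` and `X.twist` too, which gives the cover of
  -- `X` besides that of `Y`.
  have hg₀ := hG₀.of_comp hf₀
  have hg' := hG'.of_comp hf'
  refine ⟨?_, ?_, ?_, ?_⟩
  · have := TwistedDiagram.surjective_fibreProdBase X default hg₀.surjective hg'.surjective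
    obtain ⟨x, -⟩ := (X.fibreProdBase default q q').surjective (Classical.arbitrary X.X₁)
    obtain ⟨U, hU, -⟩ := exists_isComponent _
      (X.finiteEtale_fibreProdBase default hg₀.finiteEtale hg'.finiteEtale) x
    exact ⟨U, hU⟩
  · rintro U hU
    have := hU.connectedSpace
    let x : U := Classical.arbitrary U
    obtain ⟨V, hV, hxV⟩ := exists_isComponent _
      (Y.finiteEtale_fibreProdBase (f.idx default) hG₀.finiteEtale hG'.finiteEtale)
      (TwistedDiagram.fibreProdMap f default q q' x)
    -- The connected `U` has its whole image in the component of the image of any one point.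
    refine ⟨V, hV, fun y hy => ?_⟩
    have h := hV.range_subset (U.ι ≫ TwistedDiagram.fibreProdMap f default q q') x hxV
    rw [Scheme.Opens.range_ι] at h
    exact h ⟨⟨y, hy⟩, rfl⟩
  · exact hq.exists_comp_eq_of_isPullback hf₀ (TwistedDiagram.isPullback_twist f) hf' q' hG'
  · intro c hc U V hUV hU hV
    refine ⟨TwistedDiagram.isAlmostDirectGaloisCover_orbitMap X _ hX _ _ hg₀
        (X.isGaloisCover_fibreProd_component default hg₀ hg' hU),
      TwistedDiagram.isAlmostDirectGaloisCover_orbitMap Y _ hY _ _ hG₀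
        (Y.isGaloisCover_fibreProd_component _ hG₀ hG' hV), ?_⟩
    obtain ⟨j, hj₀, hj₁⟩ := TwistedDiagram.exists_closureObj_hom f default q q' c hc U V hUV
    refine ⟨j, hj₀, hj₁, ?_⟩
    apply TwistedDiagram.Hom.ext
    · exact Subsingleton.elim _ _
    · change j.f₀ ≫ q ≫ f.f₀ = q ≫ f.f₀
      rw [hj₀]
      exact Category.id_comp _
    · change j.f₁ ≫ V.ι ≫ Y.fibreProdBase _ _ _ = (U.ι ≫ X.fibreProdBase _ _ _) ≫ f.f₁
      rw [hj₁]
      exact TwistedDiagram.resLE_base f default q q' U V hUV
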